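/- Let $\mathcal S$ be the class of functions $f(z)=z+a_2z^2+a_3z^3+\cdots$ that are analytic and univalent (injective) in the open unit disc $\{|z|<1\}$. Put $$D=\Big\{(x,y)\in\mathbb R^2:\ 0\le x\le 1,\ 0\le y\le \tfrac1{\sqrt3}\sqrt{1-x^2}\Big\},$$ $$F_1(x,y)=\tfrac{4}{\sqrt5}\,x\sqrt{1-x^2-3y^2}+x^4+4y^2,$$ $$F_2(x,y)=\Big(\tfrac{2}{\sqrt7}+4xy+2x^3\Big)\sqrt{1-x^2-3y^2}+\tfrac45-\tfrac45x^2-\tfrac{12}5y^2+3x^2y^2+2y^3.$$ The functions $F_1$ and $F_2$ attain maxima on $D$, $$A=\max_D F_1=1.3614\ldots,\qquad B=\max_D F_2=1.6787\ldots$$ (that is, $1.3614\le A<1.3615$ and $1.6787\le B<1.6788$), and for every $f\in\mathcal S$: (i) the second Hankel determinant satisfies $|H_2(2)|=|a_2a_4-a_3^2|\le A$; (ii) the third Hankel determinant $$H_3(1)=\begin{vmatrix}1&a_2&a_3\\a_2&a_3&a_4\\a_3&a_4&a_5\end{vmatrix}$$ satisfies $|H_3(1)|\le B$. -/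

import Mathlib

/-- The class `𝒮` of normalised univalent functions on the open unit disc: `f` is holomorphic and
injective there, with `f 0 = 0` and `f' 0 = 1`. Values of `f` outside the disc are irrelevant. -/
def ClassS : Set (ℂ → ℂ) :=
  {f | DifferentiableOn ℂ f (Metric.ball 0 1) ∧ Set.InjOn f (Metric.ball 0 1) ∧
    f 0 = 0 ∧ deriv f 0 = 1}

/-- The `n`-th Taylor coefficient `a_n` of `f` at the origin. -/
noncomputable def taylorCoeff (f : ℂ → ℂ) (n : ℕ) : ℂ :=
  iteratedDeriv n f 0 / (n.factorial : ℂ)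

/-- The second Hankel determinant `H₂(2)` of `f`. -/
noncomputable def hankelTwoTwo (f : ℂ → ℂ) : ℂ :=
  Matrix.det !![taylorCoeff f 2, taylorCoeff f 3;
                taylorCoeff f 3, taylorCoeff f 4]

/-- The third Hankel determinant `H₃(1)` of a normalised `f` (so that `a₁ = 1`). -/
noncomputable def hankelThreeOne (f : ℂ → ℂ) : ℂ :=
  Matrix.det !![1, taylorCoeff f 2, taylorCoeff f 3;
                taylorCoeff f 2, taylorCoeff f 3, taylorCoeff f 4;
                taylorCoeff f 3, taylorCoeff f 4, taylorCoeff f 5]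

/-- The planar domain `0 ≤ x ≤ 1`, `0 ≤ y ≤ √(1 - x²) / √3`. -/
def domainD : Set (ℝ × ℝ) :=
  {p | 0 ≤ p.1 ∧ p.1 ≤ 1 ∧ 0 ≤ p.2 ∧ p.2 ≤ 1 / Real.sqrt 3 * Real.sqrt (1 - p.1 ^ 2)}

/-- The function whose maximum over `domainD` is the bound for `|H₂(2)|`. -/
noncomputable def boundF1 (p : ℝ × ℝ) : ℝ :=
  4 / Real.sqrt 5 * p.1 * Real.sqrt (1 - p.1 ^ 2 - 3 * p.2 ^ 2) + p.1 ^ 4 + 4 * p.2 ^ 2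

/-- The function whose maximum over `domainD` is the bound for `|H₃(1)|`. -/
noncomputable def boundF2 (p : ℝ × ℝ) : ℝ :=
  (2 / Real.sqrt 7 + 4 * p.1 * p.2 + 2 * p.1 ^ 3) * Real.sqrt (1 - p.1 ^ 2 - 3 * p.2 ^ 2)
    + 4 / 5 - 4 / 5 * p.1 ^ 2 - 12 / 5 * p.2 ^ 2 + 3 * p.1 ^ 2 * p.2 ^ 2 + 2 * p.2 ^ 3

open Metric Set Filter Topology MeasureTheory

/-! Write `z / f = φ²` with `φ = 1 - a z - b z² - e z³ - g z⁴ - ⋯`. Then `φ(z²)/z`, the reciprocal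
of the odd square root transform of `f`, is injective on the punctured disc, and the area theorem
gives `|a|² + 3|b|² + 5|e|² + 7|g|² ≤ 1`. Both determinants are polynomials in these four numbers
(`ClassS.exists_hankel`). For (i), the triangle inequality and `√5 |e| ≤ √(1 - |a|² - 3|b|²)`
produce `boundF1 (|a|, |b|)`. For (ii), a cruder estimate already gives `1.6787`, which is at most
`B`; `boundF2` matters only through the enclosure of its maximum.

The area theorem avoids Green's formula and Jordan curves. The area of the image of `ρ < |z| < r`
under `z⁻¹ + m z` is estimated twice: from below by Bessel's inequality on circles
(`le_volume_image_annulus`), from above by showing that the image lies in an ellipse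
(`volume_image_annulus_le`). The image of `|z| = ρ` is nearly an ellipse, and `beltramiMap` rounds
it to a circle with error `O(ρ²)`, so the upper bound is `π ρ⁻² + O(ρ)`. Cancel `π ρ⁻²`, then let `ρ
→ 0` and `r → 1`. -/

/-! ### Taylor coefficients at the origin -/

theorem taylorCoeff_zero (f : ℂ → ℂ) : taylorCoeff f 0 = f 0 := by simp [taylorCoeff]

theorem taylorCoeff_one (f : ℂ → ℂ) : taylorCoeff f 1 = deriv f 0 := by simp [taylorCoeff]

theorem taylorCoeff_congr {f g : ℂ → ℂ} (h : f =ᶠ[𝓝 0] g) (n : ℕ) :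
    taylorCoeff f n = taylorCoeff g n := by
  simp only [taylorCoeff, h.iteratedDeriv_eq]

theorem taylorCoeff_deriv (f : ℂ → ℂ) (n : ℕ) :
    taylorCoeff (deriv f) n = (n + 1 : ℂ) * taylorCoeff f (n + 1) := by
  simp only [taylorCoeff, iteratedDeriv_succ', Nat.factorial_succ]
  have : (n.factorial : ℂ) ≠ 0 := by exact_mod_cast n.factorial_ne_zero
  have : (n + 1 : ℂ) ≠ 0 := by exact_mod_cast n.succ_ne_zero
  push_cast
  field_simp

theorem taylorCoeff_dslope {f : ℂ → ℂ} (hf : AnalyticAt ℂ f 0) (n : ℕ) :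
    taylorCoeff (dslope f 0) n = taylorCoeff f (n + 1) := by
  have h1 := hf.hasFPowerSeriesAt
  have h2 := h1.has_fpower_series_dslope_fslope
  have h3 := h2.analyticAt.hasFPowerSeriesAt
  have h4 := congrArg (fun p => FormalMultilinearSeries.coeff p n) (h3.eq_formalMultilinearSeries h2)
  simpa [FormalMultilinearSeries.coeff_ofScalars, taylorCoeff] using h4

/-- Taylor expansion at the origin with holomorphic remainder. -/
theorem exists_taylor_remainder (N : ℕ) {f : ℂ → ℂ} (hf : DifferentiableOn ℂ f (ball 0 1)) :
    ∃ R : ℂ → ℂ, DifferentiableOn ℂ R (ball 0 1) ∧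
      ∀ z, f z = (∑ n ∈ Finset.range N, taylorCoeff f n * z ^ n) + z ^ N * R z := by
  induction N generalizing f with
  | zero => exact ⟨f, hf, fun z => by simp⟩
  | succ N ih =>
    have hb : ball (0 : ℂ) 1 ∈ 𝓝 0 := ball_mem_nhds _ one_pos
    have hd := (Complex.differentiableOn_dslope hb).2 hf
    obtain ⟨R, hR, h⟩ := ih hd
    refine ⟨R, hR, fun z => ?_⟩
    have h0 : f z = f 0 + z * dslope f 0 z := by
      have := sub_smul_dslope f 0 z
      simp at this
      rw [this]; ring
    rw [h0, h z, Finset.sum_range_succ', taylorCoeff_zero, mul_add, Finset.mul_sum]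
    simp only [taylorCoeff_dslope (hf.analyticAt hb)]
    have : ∀ n, z * (taylorCoeff f (n + 1) * z ^ n) = taylorCoeff f (n + 1) * z ^ (n + 1) :=
      fun n => by ring
    simp only [this]
    ring

/-- Uniqueness of the Taylor expansion. -/
theorem taylorCoeff_eq_of_expansion (N : ℕ) {f R : ℂ → ℂ} {c : ℕ → ℂ}
    (hR : AnalyticAt ℂ R 0)
    (h : ∀ᶠ z in 𝓝 0, f z = (∑ n ∈ Finset.range N, c n * z ^ n) + z ^ N * R z)
    {n : ℕ} (hn : n < N) : taylorCoeff f n = c n := by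
  induction N generalizing f c n with
  | zero => omega
  | succ N ih =>
    have hf0 : f 0 = c 0 := by
      rw [h.self_of_nhds, Finset.sum_range_succ']; simp
    cases n with
    | zero => rw [taylorCoeff_zero, hf0]
    | succ n =>
      have hfa : AnalyticAt ℂ f 0 := by
        refine AnalyticAt.congr ?_ (h.mono fun z hz => hz.symm)
        fun_prop
      rw [← taylorCoeff_dslope hfa]
      refine ih (f := dslope f 0) (c := fun n => c (n + 1)) ?_ (by omega)
      have hda : AnalyticAt ℂ (dslope f 0) 0 := by
        obtain ⟨p, hp⟩ := hfa
        exact hp.has_fpower_series_dslope_fslope.analyticAt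
      have hga : AnalyticAt ℂ (fun z => (∑ n ∈ Finset.range N, c (n + 1) * z ^ n) + z ^ N * R z) 0 := by
        fun_prop
      have hne : ∀ᶠ z in 𝓝[≠] (0 : ℂ), dslope f 0 z =
          (∑ n ∈ Finset.range N, c (n + 1) * z ^ n) + z ^ N * R z := by
        filter_upwards [h.filter_mono nhdsWithin_le_nhds, self_mem_nhdsWithin] with z hz hz0
        have hz0 : z ≠ 0 := hz0
        have h1 := sub_smul_dslope f 0 z
        simp only [sub_zero, smul_eq_mul] at h1
        apply mul_left_cancel₀ hz0
        rw [h1, hz, hf0, Finset.sum_range_succ', mul_add, Finset.mul_sum]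
        have : ∀ n, z * (c (n + 1) * z ^ n) = c (n + 1) * z ^ (n + 1) := fun n => by ring
        simp only [this]
        ring
      -- Dividing by `z` proves the expansion only off the origin; the identity theorem restores it
      -- on a full neighbourhood.
      exact (hda.frequently_eq_iff_eventually_eq hga).1 hne.frequently

/-! ### Holomorphic inverse square root -/

/-- A nonvanishing holomorphic function on the unit disc with value `1` at the origin has an
inverse square root. -/
theorem exists_inverse_sqrt {F : ℂ → ℂ} (hF : DifferentiableOn ℂ F (ball 0 1)) (h0 : F 0 = 1)
    (hne : ∀ z ∈ ball (0 : ℂ) 1, F z ≠ 0) :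
    ∃ φ : ℂ → ℂ, DifferentiableOn ℂ φ (ball 0 1) ∧ φ 0 = 1 ∧
      ∀ z ∈ ball (0 : ℂ) 1, φ z ^ 2 * F z = 1 := by
  have hd : DifferentiableOn ℂ (fun z => deriv F z / F z) (ball 0 1) :=
    (hF.deriv isOpen_ball).div hF hne
  obtain ⟨G, hG0, hG⟩ := hd.isExactOn_ball.with_val_at 0 0
  refine ⟨fun z => Complex.exp (-G z / 2), ?_, by simp [hG0], fun z hz => ?_⟩
  · intro z hz
    exact ((hG z hz).differentiableAt.neg.div_const 2).cexp.differentiableWithinAt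
  -- `G` is a primitive of `F'/F`, so `exp (-G) * F` is constant.
  · have hder : ∀ w ∈ ball (0 : ℂ) 1, HasDerivAt (fun w => Complex.exp (-G w) * F w) 0 w := by
      intro w hw
      have h1 := ((hG w hw).neg.cexp).mul
        ((hF w hw).differentiableAt (isOpen_ball.mem_nhds hw)).hasDerivAt
      refine h1.congr_deriv ?_
      have := hne w hw
      simp only [Pi.neg_apply]
      field_simp
      ring
    have hc := (convex_ball (0 : ℂ) 1).is_const_of_fderivWithin_eq_zero (𝕜 := ℂ)
      (f := fun w => Complex.exp (-G w) * F w)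
      (fun w hw => (hder w hw).differentiableAt.differentiableWithinAt)
      (fun w hw => by
        have := (hder w hw).hasFDerivAt.hasFDerivWithinAt (s := ball 0 1)
        rw [this.fderivWithin (isOpen_ball.uniqueDiffWithinAt hw)]
        ext; simp) hz (mem_ball_self one_pos)
    simp only [hG0, h0, neg_zero, Complex.exp_zero, mul_one] at hc
    rw [← hc, ← Complex.exp_nat_mul]
    congr 2
    push_cast; ring

/-! ### Bessel's inequality on circles -/

theorem fourierCoeffOn_comp_circleMap {F : ℂ → ℂ} {s : ℝ} (hs : 0 < s) (n : ℤ) :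
    fourierCoeffOn Real.two_pi_pos (fun θ => F (circleMap 0 s θ)) n =
      (s : ℂ) ^ n * Real.circleAverage (fun z => z ^ (-n) * F z) 0 s := by
  rw [fourierCoeffOn_eq_integral, Real.circleAverage_def, sub_zero, mul_smul_comm, one_div]
  congr 1
  rw [← intervalIntegral.integral_const_mul]
  refine intervalIntegral.integral_congr fun θ _ => ?_
  have hs' : (s : ℂ) ≠ 0 := by exact_mod_cast hs.ne'
  have hpi : (Real.pi : ℂ) ≠ 0 := by exact_mod_cast Real.pi_ne_zero
  simp only [fourier_coe_apply, smul_eq_mul, circleMap, zero_add]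
  rw [mul_zpow, ← Complex.exp_int_mul, ← mul_assoc, ← mul_assoc, ← zpow_add₀ hs']
  simp only [add_neg_cancel, zpow_zero, one_mul]
  congr 2
  push_cast
  field_simp

/-- Bessel's inequality on a circle. -/
theorem sum_sq_le_circleAverage {F : ℂ → ℂ} {s : ℝ} (hs : 0 < s)
    (hF : ContinuousOn F (sphere 0 s)) (S : Finset ℤ) :
    ∑ n ∈ S, ‖(s : ℂ) ^ n * Real.circleAverage (fun z => z ^ (-n) * F z) 0 s‖ ^ 2 ≤
      Real.circleAverage (fun z => ‖F z‖ ^ 2) 0 s := by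
  have hc : Continuous fun θ => F (circleMap 0 s θ) := by
    refine hF.comp_continuous (continuous_circleMap 0 s) fun θ => circleMap_mem_sphere 0 hs.le θ
  have hL : MemLp (fun θ => F (circleMap 0 s θ)) 2 (volume.restrict (Ioc 0 (2 * Real.pi))) := by
    obtain ⟨M, hM⟩ := (isCompact_Icc (a := 0) (b := 2 * Real.pi)).exists_bound_of_continuousOn
      hc.continuousOn
    refine MemLp.of_bound hc.aestronglyMeasurable M ?_
    filter_upwards [ae_restrict_mem measurableSet_Ioc] with θ hθ
    exact hM θ (Ioc_subset_Icc_self hθ)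
  have h := hasSum_sq_fourierCoeffOn Real.two_pi_pos hL
  simp only [fourierCoeffOn_comp_circleMap hs, sub_zero] at h
  exact sum_le_hasSum S (fun _ _ => by positivity) h

theorem circleAverage_zpow {s : ℝ} (hs : 0 < s) {n : ℤ} (hn : n ≠ 0) :
    Real.circleAverage (fun z : ℂ => z ^ n) 0 s = 0 := by
  rw [Real.circleAverage_eq_circleIntegral hs.ne']
  have h := circleIntegral.integral_sub_zpow_of_ne (n := n - 1) (by omega) 0 0 s
  rw [circleIntegral.integral_congr (g := fun z => (z - 0) ^ (n - 1)) hs.le, h, smul_zero]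
  intro z hz
  have : z ≠ 0 := ne_of_mem_sphere hz hs.ne'
  simp [zpow_sub_one₀ this, mul_comm]

theorem circleAverage_zpow_mul {D : ℂ → ℂ} {s : ℝ} (hs : 0 < s)
    (hD : DifferentiableOn ℂ D (closedBall 0 s)) (n : ℕ) :
    Real.circleAverage (fun z : ℂ => z ^ (-(n : ℤ)) * D z) 0 s = taylorCoeff D n := by
  rw [Real.circleAverage_eq_circleIntegral hs.ne']
  have h := hD.circleIntegral_one_div_sub_center_pow_smul hs n
  rw [circleIntegral.integral_congr (g := fun z => (1 / (z - 0) ^ (n + 1)) • D z) hs.le, h]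
  · simp only [smul_eq_mul, taylorCoeff]
    have := Complex.two_pi_I_ne_zero
    field_simp
  intro z hz
  have : z ≠ 0 := ne_of_mem_sphere hz hs.ne'
  simp [zpow_neg, pow_succ]
  ring

/-- Bessel's inequality for a function with a double pole at the origin. -/
theorem sum_taylorCoeff_le_circleAverage {D : ℂ → ℂ} {s : ℝ} (hs : 0 < s)
    (hD : DifferentiableOn ℂ D (closedBall 0 s)) (N : ℕ) :
    (s ^ 4)⁻¹ + ∑ n ∈ Finset.range N, ‖taylorCoeff D n‖ ^ 2 * s ^ (2 * n) ≤
      Real.circleAverage (fun z => ‖-(z ^ 2)⁻¹ + D z‖ ^ 2) 0 s := by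
  have hne : ∀ z ∈ sphere (0 : ℂ) s, z ≠ 0 := fun z hz => ne_of_mem_sphere hz hs.ne'
  have hDs : ContinuousOn D (sphere 0 s) := hD.continuousOn.mono sphere_subset_closedBall
  have hpow : ∀ n : ℤ, ContinuousOn (fun z : ℂ => z ^ n) (sphere 0 s) := fun n =>
    continuousOn_id.zpow₀ n fun z hz => Or.inl (hne z hz)
  have hF : ContinuousOn (fun z => -(z ^ 2)⁻¹ + D z) (sphere 0 s) :=
    (((continuousOn_id.pow 2).inv₀ fun z hz => pow_ne_zero 2 (hne z hz)).neg).add hDs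
  have havg : ∀ n : ℤ, Real.circleAverage (fun z => z ^ (-n) * (-(z ^ 2)⁻¹ + D z)) 0 s =
      Real.circleAverage (fun z => z ^ (-n) * D z) 0 s -
        Real.circleAverage (fun z : ℂ => z ^ (-n - 2)) 0 s := by
    intro n
    rw [← Real.circleAverage_fun_sub]
    · refine Real.circleAverage_congr_sphere fun z hz => ?_
      rw [abs_of_pos hs] at hz
      have := hne z hz
      simp only [zpow_sub₀ this]
      simp
      ring
    · exact ((hpow _).mul hDs).circleIntegrable hs.le
    · exact (hpow _).circleIntegrable hs.le
  have hb := sum_sq_le_circleAverage hs hF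
    -- Index `-2` picks up the pole, the indices `n ≥ 0` the Taylor coefficients of `D`.
    (insert (-2) ((Finset.range N).map Nat.castEmbedding))
  rw [Finset.sum_insert (by simp), Finset.sum_map] at hb
  refine le_trans (le_of_eq ?_) hb
  congr 1
  · rw [havg]
    -- At index `-2` the regular part contributes the mean of `z² D z`, which is its value `0` at
    -- the centre.
    have h1 := circleAverage_zpow_mul (D := fun z => z ^ 2 * D z) hs
      ((differentiableOn_id.pow 2).mul hD) 0
    simp only [taylorCoeff_zero] at h1
    have h2 : Real.circleAverage (fun z : ℂ => z ^ (-(-2) : ℤ) * D z) 0 s = 0 := by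
      simpa using h1
    rw [h2]
    simp [Real.circleAverage_const, ← pow_mul]
  · refine Finset.sum_congr rfl fun n _ => ?_
    rw [Nat.castEmbedding_apply, havg, circleAverage_zpow_mul hs hD, circleAverage_zpow hs (by omega)]
    simp [mul_pow, abs_of_pos hs, pow_mul']
    ring

/-! ### Area of the image of an annulus, from below -/

theorem lintegral_annulus {g : ℂ → ℝ} (hm : Measurable g) (hg0 : ∀ z, 0 ≤ g z)
    (hg : ContinuousOn g (ball 0 1 \ {0})) {ρ r : ℝ} (hρ : 0 < ρ) (hr : r < 1) :
    ∫⁻ z in {z : ℂ | ρ < ‖z‖ ∧ ‖z‖ < r}, ENNReal.ofReal (g z) =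
      ∫⁻ s in Ioo ρ r, ENNReal.ofReal (2 * Real.pi * s * Real.circleAverage g 0 s) := by
  set A := {z : ℂ | ρ < ‖z‖ ∧ ‖z‖ < r}
  have hA : MeasurableSet A :=
    (measurableSet_lt measurable_const measurable_norm).inter
      (measurableSet_lt measurable_norm measurable_const)
  have hmI : Measurable (A.indicator fun z => ENNReal.ofReal (g z)) :=
    hm.ennreal_ofReal.indicator hA
  have hsym : Measurable fun p : ℝ × ℝ => Complex.polarCoord.symm p := by
    simp only [Complex.polarCoord_symm_apply]
    fun_prop
  rw [← lintegral_indicator hA, ← Complex.lintegral_comp_polarCoord_symm, polarCoord_target,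
    Measure.volume_eq_prod, ← Measure.prod_restrict, lintegral_prod]
  swap
  · exact (measurable_fst.ennreal_ofReal.mul (hmI.comp hsym)).aemeasurable
  have hin : ∀ s ∈ Ioi (0 : ℝ),
      ∫⁻ θ in Ioo (-Real.pi) Real.pi, ENNReal.ofReal s •
        A.indicator (fun z => ENNReal.ofReal (g z)) (Complex.polarCoord.symm (s, θ)) =
      (Ioo ρ r).indicator
        (fun s => ENNReal.ofReal (2 * Real.pi * s * Real.circleAverage g 0 s)) s := by
    intro s hs
    have hs : 0 < s := hs
    have hcm : ∀ θ : ℝ, Complex.polarCoord.symm (s, θ) = circleMap 0 s θ := by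
      intro θ
      simp [circleMap, Complex.exp_mul_I]
    have hmem : ∀ θ : ℝ, circleMap 0 s θ ∈ A ↔ s ∈ Ioo ρ r := by
      intro θ
      simp [A, abs_of_pos hs]
    by_cases hsr : s ∈ Ioo ρ r
    · simp only [hcm, indicator_of_mem hsr, indicator_of_mem ((hmem _).2 hsr)]
      simp only [smul_eq_mul]
      have hcont : Continuous fun θ => g (circleMap 0 s θ) := by
        refine hg.comp_continuous (continuous_circleMap 0 s) fun θ => ?_
        constructor
        · simpa [abs_of_pos hs] using hsr.2.trans hr
        · simp [hs.ne']
      rw [lintegral_const_mul _ (by fun_prop), ← ofReal_integral_eq_lintegral_ofReal,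
        ← ENNReal.ofReal_mul hs.le, ← integral_Ioc_eq_integral_Ioo,
        ← intervalIntegral.integral_of_le (by linarith [Real.pi_pos]),
        Real.circleAverage_eq_integral_add (-Real.pi),
        intervalIntegral.integral_comp_add_right (fun θ => g (circleMap 0 s θ))]
      · congr 1
        have := Real.pi_ne_zero
        rw [zero_add, show 2 * Real.pi + -Real.pi = Real.pi by ring, smul_eq_mul]
        field_simp
      · exact (hcont.integrableOn_Icc).mono_set Ioo_subset_Icc_self
      · exact Eventually.of_forall fun θ => hg0 _
    · simp only [hcm, indicator_of_notMem hsr, indicator_of_notMem (fun h => hsr ((hmem _).1 h))]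
      simp
  rw [setLIntegral_congr_fun measurableSet_Ioi hin, lintegral_indicator measurableSet_Ioo,
    Measure.restrict_restrict measurableSet_Ioo,
    inter_eq_self_of_subset_left (t := Ioi 0) fun s hs => hρ.trans hs.1]

theorem hasDerivAt_inv_add {m : ℂ → ℂ} (hm : DifferentiableOn ℂ m (ball 0 1)) {z : ℂ}
    (hz : z ∈ ball (0 : ℂ) 1 \ {0}) :
    HasDerivAt (fun z => z⁻¹ + m z) (-(z ^ 2)⁻¹ + deriv m z) z :=
  (hasDerivAt_inv hz.2).add ((hm z hz.1).differentiableAt (isOpen_ball.mem_nhds hz.1)).hasDerivAt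

/-- Lower bound for the area of the image of an annulus. -/
theorem le_volume_image_annulus {m : ℂ → ℂ} (hm : DifferentiableOn ℂ m (ball 0 1))
    (hinj : InjOn (fun z => z⁻¹ + m z) (ball 0 1 \ {0})) {ρ r : ℝ} (hρ : 0 < ρ) (hρr : ρ ≤ r)
    (hr : r < 1) (N : ℕ) :
    ENNReal.ofReal (Real.pi * ((ρ ^ 2)⁻¹ - (r ^ 2)⁻¹ + ∑ n ∈ Finset.range N,
      (n + 1) * ‖taylorCoeff m (n + 1)‖ ^ 2 * (r ^ (2 * n + 2) - ρ ^ (2 * n + 2)))) ≤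
    volume ((fun z => z⁻¹ + m z) '' {z : ℂ | ρ < ‖z‖ ∧ ‖z‖ < r}) := by
  set h : ℂ → ℂ := fun z => z⁻¹ + m z
  set A := {z : ℂ | ρ < ‖z‖ ∧ ‖z‖ < r}
  have hA : MeasurableSet A :=
    (measurableSet_lt measurable_const measurable_norm).inter
      (measurableSet_lt measurable_norm measurable_const)
  have hAsub : A ⊆ ball 0 1 \ {0} := fun z hz =>
    ⟨by simpa using hz.2.trans hr, fun h0 => by
      rw [mem_singleton_iff.1 h0] at hz; simpa using hρ.trans hz.1⟩
  have hd : ∀ z ∈ ball (0 : ℂ) 1 \ {0}, deriv h z = -(z ^ 2)⁻¹ + deriv m z := fun z hz =>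
    (hasDerivAt_inv_add hm hz).deriv
  have hdm : DifferentiableOn ℂ (deriv m) (ball 0 1) := hm.deriv isOpen_ball
  -- Change of variables: the real Jacobian of multiplication by `h'` is `|h'|²`.
  have harea : ∫⁻ z in A, ENNReal.ofReal (‖deriv h z‖ ^ 2) = volume (h '' A) := by
    rw [← lintegral_abs_det_fderiv_eq_addHaar_image volume hA
      (f' := fun z => (ContinuousLinearMap.toSpanSingleton ℂ (deriv h z)).restrictScalars ℝ)
      (fun z hz => ?_) (hinj.mono hAsub)]
    · refine lintegral_congr fun z => ?_
      congr 1
      simp [ContinuousLinearMap.det, LinearMap.det_restrictScalars, Algebra.norm_complex_eq,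
        Complex.normSq_eq_norm_sq]
    · have h1 := hasDerivAt_inv_add hm (hAsub hz)
      rw [← h1.deriv] at h1
      exact (h1.hasFDerivAt.restrictScalars ℝ).hasFDerivWithinAt
  have hcont : ContinuousOn (fun z => ‖deriv h z‖ ^ 2) (ball 0 1 \ {0}) := by
    have : ContinuousOn (fun z => ‖-(z ^ 2)⁻¹ + deriv m z‖ ^ 2) (ball 0 1 \ {0}) := by
      refine ((((continuousOn_id.pow 2).inv₀ fun z hz => pow_ne_zero 2 hz.2).neg).add
        (hdm.continuousOn.mono sdiff_subset)).norm.pow 2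
    exact this.congr fun z hz => by simp only [hd z hz]
  rw [← harea, lintegral_annulus ((measurable_deriv h).norm.pow_const 2)
    (fun z => by positivity) hcont hρ hr]
  -- `Ψ s` is Bessel's lower bound for the integral of `|h'|²` over the circle of radius `s`, and
  -- `Φ` is an antiderivative of it.
  set Φ : ℝ → ℝ := fun s => Real.pi * (-(s ^ 2)⁻¹ + ∑ n ∈ Finset.range N,
    (n + 1) * ‖taylorCoeff m (n + 1)‖ ^ 2 * s ^ (2 * n + 2))
  set Ψ : ℝ → ℝ := fun s => 2 * Real.pi * s * ((s ^ 4)⁻¹ + ∑ n ∈ Finset.range N,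
    ‖taylorCoeff (deriv m) n‖ ^ 2 * s ^ (2 * n))
  have hΦ : ∀ s, s ≠ 0 → HasDerivAt Φ (Ψ s) s := by
    intro s hs
    have h1 : HasDerivAt (fun s : ℝ => -(s ^ 2)⁻¹) (2 * s * (s ^ 4)⁻¹) s := by
      refine (((hasDerivAt_pow 2 s).inv (pow_ne_zero 2 hs)).neg).congr_deriv ?_
      field_simp
      norm_num
      ring
    have h2 : HasDerivAt (fun s : ℝ => ∑ n ∈ Finset.range N,
        (n + 1) * ‖taylorCoeff m (n + 1)‖ ^ 2 * s ^ (2 * n + 2))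
        (∑ n ∈ Finset.range N, (n + 1) * ‖taylorCoeff m (n + 1)‖ ^ 2 *
          ((2 * n + 2 : ℕ) * s ^ (2 * n + 2 - 1))) s :=
      HasDerivAt.fun_sum fun n _ => (hasDerivAt_pow _ s).const_mul _
    refine ((h1.add h2).const_mul Real.pi).congr_deriv ?_
    simp only [Ψ, taylorCoeff_deriv, mul_add, Finset.mul_sum]
    congr 1
    · ring
    · refine Finset.sum_congr rfl fun n _ => ?_
      have : ‖(n + 1 : ℂ)‖ = n + 1 := by
        have := Complex.norm_natCast (n + 1)
        push_cast at this
        exact this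
      rw [norm_mul, this, show 2 * n + 2 - 1 = 2 * n + 1 by omega]
      push_cast
      ring
  have hΨc : ContinuousOn Ψ (Icc ρ r) := by
    have : ContinuousOn (fun s : ℝ => (s ^ 4)⁻¹) (Icc ρ r) :=
      (continuousOn_id.pow 4).inv₀ fun s hs => pow_ne_zero 4 (hρ.trans_le hs.1).ne'
    fun_prop
  have hint : ∫ s in Ioo ρ r, Ψ s = Φ r - Φ ρ := by
    rw [← integral_Ioc_eq_integral_Ioo, ← intervalIntegral.integral_of_le hρr]
    refine intervalIntegral.integral_eq_sub_of_hasDerivAt (fun s hs => hΦ s ?_) ?_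
    · rw [uIcc_of_le hρr] at hs
      exact (hρ.trans_le hs.1).ne'
    · exact ContinuousOn.intervalIntegrable (by rwa [uIcc_of_le hρr])
  calc _ = ENNReal.ofReal (∫ s in Ioo ρ r, Ψ s) := by
        rw [hint]
        congr 1
        simp only [Φ, mul_sub, Finset.sum_sub_distrib]
        ring
    _ = ∫⁻ s in Ioo ρ r, ENNReal.ofReal (Ψ s) := by
        refine ofReal_integral_eq_lintegral_ofReal
          (hΨc.integrableOn_Icc.mono_set Ioo_subset_Icc_self) ?_
        filter_upwards [ae_restrict_mem measurableSet_Ioo] with s hs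
        have : 0 < s := hρ.trans hs.1
        simp only [Ψ, Pi.zero_apply]
        positivity
    _ ≤ _ := by
        refine setLIntegral_mono' measurableSet_Ioo fun s hs => ENNReal.ofReal_le_ofReal ?_
        have hs0 : 0 < s := hρ.trans hs.1
        refine mul_le_mul_of_nonneg_left ?_ (by have := Real.pi_pos; positivity)
        refine (sum_taylorCoeff_le_circleAverage hs0 (hdm.mono ?_) N).trans (le_of_eq ?_)
        · exact closedBall_subset_ball (hs.2.trans hr)
        · refine Real.circleAverage_congr_sphere fun z hz => ?_
          rw [abs_of_pos hs0] at hz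
          rw [hd]
          refine ⟨?_, ne_of_mem_sphere hz hs0.ne'⟩
          rw [mem_ball, mem_sphere.1 hz]
          exact hs.2.trans hr

/-! ### Area of the image of an annulus, from above -/

/-- The exponential maps a half-plane, which is convex, onto the exterior of a disc. -/
theorem isPreconnected_setOf_lt_norm {R : ℝ} (hR : 0 < R) :
    IsPreconnected {w : ℂ | R < ‖w‖} := by
  have h : {w : ℂ | R < ‖w‖} = Complex.exp '' {z | Real.log R < z.re} := by
    ext w
    constructor
    · intro hw
      have hw0 : w ≠ 0 := norm_pos_iff.1 (hR.trans hw)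
      refine ⟨Complex.log w, ?_, Complex.exp_log hw0⟩
      simpa [Complex.log_re] using Real.log_lt_log hR hw
    · rintro ⟨z, hz, rfl⟩
      simpa [Complex.norm_exp] using (Real.log_lt_iff_lt_exp hR).1 hz
  rw [h]
  exact ((convex_halfSpace_re_gt _).isPreconnected).image _ Complex.continuous_exp.continuousOn

/-- The real-linear map `w ↦ w + κ * conj w`. -/
noncomputable def beltramiMap (κ : ℂ) : ℂ →ₗ[ℝ] ℂ :=
  LinearMap.id + (LinearMap.mulLeft ℝ κ).comp Complex.conjLIE.toLinearEquiv.toLinearMap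

theorem beltramiMap_apply (κ w : ℂ) :
    beltramiMap κ w = w + κ * (starRingEnd ℂ) w := by
  simp [beltramiMap]

theorem det_beltramiMap (κ : ℂ) : LinearMap.det (beltramiMap κ) = 1 - ‖κ‖ ^ 2 := by
  rw [← LinearMap.det_toMatrix Complex.basisOneI, Matrix.det_fin_two]
  simp only [LinearMap.toMatrix_apply, beltramiMap_apply, Complex.coe_basisOneI,
    Complex.coe_basisOneI_repr]
  simp [Complex.sq_norm, Complex.normSq_apply]
  ring

theorem isPreconnected_beltramiMap {κ : ℂ} (hκ : ‖κ‖ < 1) {R : ℝ} (hR : 0 < R) :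
    IsPreconnected {w : ℂ | R < ‖beltramiMap κ w‖} := by
  have hdet : LinearMap.det (beltramiMap κ) ≠ 0 := by
    rw [det_beltramiMap]
    nlinarith [norm_nonneg κ]
  set e := (beltramiMap κ).equivOfDetNeZero hdet
  have h : {w : ℂ | R < ‖beltramiMap κ w‖} = e.symm '' {w : ℂ | R < ‖w‖} := by
    rw [LinearEquiv.image_symm_eq_preimage]
    rfl
  rw [h]
  exact (isPreconnected_setOf_lt_norm hR).image _
    (LinearMap.continuous_of_finiteDimensional e.symm.toLinearMap).continuousOn

section Punctured

variable {m : ℂ → ℂ}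

theorem analyticAt_inv_add (hm : DifferentiableOn ℂ m (ball 0 1)) {z : ℂ}
    (hz : z ∈ ball (0 : ℂ) 1 \ {0}) : AnalyticAt ℂ (fun z => z⁻¹ + m z) z :=
  (analyticAt_inv hz.2).add (hm.analyticAt (isOpen_ball.mem_nhds hz.1))

/-- Open mapping theorem at each point; injectivity excludes the locally constant case. -/
theorem isOpen_image_inv_add (hm : DifferentiableOn ℂ m (ball 0 1))
    (hinj : InjOn (fun z => z⁻¹ + m z) (ball 0 1 \ {0})) {V : Set ℂ} (hV : IsOpen V)
    (hVs : V ⊆ ball 0 1 \ {0}) : IsOpen ((fun z => z⁻¹ + m z) '' V) := by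
  rw [isOpen_iff_mem_nhds]
  rintro _ ⟨z, hz, rfl⟩
  rcases (analyticAt_inv_add hm (hVs hz)).eventually_constant_or_nhds_le_map_nhds with h | h
  · exfalso
    have h1 : ∀ᶠ w in 𝓝[≠] z, w = z := by
      filter_upwards [h.filter_mono nhdsWithin_le_nhds,
        nhdsWithin_le_nhds (hV.mem_nhds hz)] with w hw hwV
      exact hinj (hVs hwV) (hVs hz) hw
    obtain ⟨w, hw, hwz⟩ := (h1.and self_mem_nhdsWithin).exists
    exact hwz hw
  · exact h (image_mem_map (hV.mem_nhds hz))

/-- With the pole cleared, the image is the projection to `w` of the closed set `1 + z m(z) - z w =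
0` along the compact `z`-disc. The point `z = 0` drops out by itself, since it would give `1 = 0`.
-/
theorem isClosed_image_inv_add (hm : DifferentiableOn ℂ m (ball 0 1)) {ρ : ℝ} (hρ : ρ < 1) :
    IsClosed ((fun z => z⁻¹ + m z) '' (closedBall 0 ρ \ {0})) := by
  have hmc : ContinuousOn m (closedBall 0 ρ) := hm.continuousOn.mono (closedBall_subset_ball hρ)
  have : CompactSpace (closedBall (0 : ℂ) ρ) := isCompact_iff_compactSpace.1 (isCompact_closedBall _ _)
  have hc : Continuous fun p : closedBall (0 : ℂ) ρ × ℂ => 1 + p.1.1 * m p.1.1 - p.1.1 * p.2 := by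
    have h1 : Continuous fun z : closedBall (0 : ℂ) ρ => m z.1 := hmc.domRestrict
    have h2 : Continuous fun p : closedBall (0 : ℂ) ρ × ℂ => m p.1.1 := h1.comp continuous_fst
    have h3 : Continuous fun p : closedBall (0 : ℂ) ρ × ℂ => p.1.1 :=
      continuous_subtype_val.comp continuous_fst
    exact (continuous_const.add (h3.mul h2)).sub (h3.mul continuous_snd)
  have hcl := isClosedMap_snd_of_compactSpace _ (isClosed_singleton.preimage hc (t := {0}))
  convert hcl using 1
  ext w
  constructor
  · rintro ⟨z, ⟨hz, hz0⟩, rfl⟩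
    refine ⟨(⟨z, hz⟩, z⁻¹ + m z), ?_, rfl⟩
    have hz0 : z ≠ 0 := hz0
    simp only [mem_preimage, mem_singleton_iff]
    field_simp
    ring
  · rintro ⟨⟨⟨z, hz⟩, w⟩, h, rfl⟩
    simp only [mem_preimage, mem_singleton_iff] at h
    have hz0 : z ≠ 0 := by rintro rfl; simp at h
    refine ⟨z, ⟨hz, hz0⟩, ?_⟩
    simp only
    field_simp
    linear_combination h

/-- A connected set that avoids the image of a circle and meets the image of its punctured
interior is covered by that image. -/
theorem subset_image_of_isPreconnected (hm : DifferentiableOn ℂ m (ball 0 1))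
    (hinj : InjOn (fun z => z⁻¹ + m z) (ball 0 1 \ {0})) {ρ : ℝ} (hρ : ρ < 1) {U : Set ℂ}
    (hU : IsPreconnected U) (hUs : ∀ z ∈ sphere (0 : ℂ) ρ, z⁻¹ + m z ∉ U)
    (hne : ∃ z ∈ ball (0 : ℂ) ρ \ {0}, z⁻¹ + m z ∈ U) :
    U ⊆ (fun z => z⁻¹ + m z) '' (ball 0 ρ \ {0}) := by
  -- The image of the open punctured disc and the complement of the image of the closed one are
  -- disjoint open sets; they cover `U` because `U` misses the image of the circle.
  refine hU.subset_left_of_subset_union (v := ((fun z => z⁻¹ + m z) '' (closedBall 0 ρ \ {0}))ᶜ)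
    (isOpen_image_inv_add hm hinj (isOpen_ball.sdiff isClosed_singleton) ?_)
    (isClosed_image_inv_add hm hρ).isOpen_compl ?_ ?_ ?_
  · exact sdiff_subset_sdiff_left (ball_subset_ball hρ.le)
  · exact disjoint_compl_right.mono_left
      (image_mono (sdiff_subset_sdiff_left ball_subset_closedBall))
  · intro w hw
    by_cases h : w ∈ (fun z => z⁻¹ + m z) '' (closedBall 0 ρ \ {0})
    · obtain ⟨z, ⟨hz, hz0⟩, rfl⟩ := h
      refine Or.inl ⟨z, ⟨?_, hz0⟩, rfl⟩
      rcases (mem_closedBall.1 hz).lt_or_eq with h | h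
      · exact h
      · exact absurd hw (hUs z h)
    · exact Or.inr h
  · obtain ⟨z, hz, hzU⟩ := hne
    exact ⟨_, hzU, z, hz, rfl⟩

theorem norm_inv_add_tendsto (hm : ContinuousAt m 0) :
    Tendsto (fun z => ‖z⁻¹ + m z‖) (𝓝[≠] 0) atTop := by
  have h1 : Tendsto (fun z => ‖z⁻¹‖ + -‖m z‖) (𝓝[≠] 0) atTop := by
    refine tendsto_atTop_add_right_of_le' _ (-(‖m 0‖ + 1)) ?_ ?_
    · simpa using tendsto_norm_inv_nhdsNE_zero_atTop (α := ℂ)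
    · have := hm.norm.eventually (gt_mem_nhds (lt_add_one ‖m 0‖))
      filter_upwards [this.filter_mono nhdsWithin_le_nhds] with z hz
      linarith
  refine tendsto_atTop_mono (fun z => ?_) h1
  have := norm_sub_norm_le z⁻¹ (-m z)
  simp only [norm_neg, sub_neg_eq_add] at this
  linarith

/-- Upper bound for the area of the image of an annulus. -/
theorem volume_image_annulus_le (hm : DifferentiableOn ℂ m (ball 0 1))
    (hinj : InjOn (fun z => z⁻¹ + m z) (ball 0 1 \ {0})) {ρ r R : ℝ} (hρ : 0 < ρ)
    (hr : r < 1) (hρr : ρ ≤ r) (hR : 0 < R) {κ : ℂ} (hκ : ‖κ‖ < 1)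
    (hb : ∀ z ∈ sphere (0 : ℂ) ρ, ‖beltramiMap κ (z⁻¹ + m z)‖ ≤ R) :
    volume ((fun z => z⁻¹ + m z) '' {z : ℂ | ρ < ‖z‖ ∧ ‖z‖ < r}) ≤
      ENNReal.ofReal (Real.pi * R ^ 2 / (1 - ‖κ‖ ^ 2)) := by
  have hκ2 : 0 < 1 - ‖κ‖ ^ 2 := by nlinarith [norm_nonneg κ]
  have hm0 : ContinuousAt m 0 :=
    (hm 0 (mem_ball_self one_pos)).differentiableAt (ball_mem_nhds _ one_pos) |>.continuousAt
  have hlow : ∀ w, (1 - ‖κ‖) * ‖w‖ ≤ ‖beltramiMap κ w‖ := by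
    intro w
    rw [beltramiMap_apply]
    have := norm_sub_norm_le w (-(κ * (starRingEnd ℂ) w))
    simp only [norm_neg, sub_neg_eq_add, norm_mul, RCLike.norm_conj] at this
    linarith
  -- The exterior of the ellipse is connected and is met near the pole, so points with `|z| < ρ`
  -- already fill it; by injectivity the annulus maps inside the ellipse.
  have hcover := subset_image_of_isPreconnected hm hinj (hρr.trans_lt hr)
    (isPreconnected_beltramiMap hκ hR) (fun z hz => not_lt.2 (hb z hz)) (by
      have h1 := (norm_inv_add_tendsto hm0).eventually_gt_atTop (R / (1 - ‖κ‖))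
      have h2 : ball (0 : ℂ) ρ \ {0} ∈ 𝓝[≠] (0 : ℂ) :=
        inter_mem (nhdsWithin_le_nhds (ball_mem_nhds 0 hρ)) self_mem_nhdsWithin
      obtain ⟨z, hz, hzb⟩ := (h1.and (eventually_mem_set.2 h2)).exists
      refine ⟨z, hzb, lt_of_lt_of_le ?_ (hlow _)⟩
      rwa [div_lt_iff₀' (by linarith)] at hz)
  have hsub : (fun z => z⁻¹ + m z) '' {z : ℂ | ρ < ‖z‖ ∧ ‖z‖ < r} ⊆
      beltramiMap κ ⁻¹' closedBall 0 R := by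
    rintro _ ⟨z, hz, rfl⟩
    rw [mem_preimage, mem_closedBall_zero_iff]
    by_contra! hlt
    obtain ⟨w, ⟨hw, hw0⟩, hwz⟩ := hcover hlt
    rw [mem_ball_zero_iff] at hw
    have : w = z := by
      refine hinj ⟨?_, hw0⟩ ⟨?_, ?_⟩ hwz
      · rw [mem_ball_zero_iff]; linarith
      · rw [mem_ball_zero_iff]; exact hz.2.trans hr
      · exact norm_pos_iff.1 (hρ.trans hz.1)
    rw [this] at hw
    exact lt_asymm hw hz.1
  refine (measure_mono hsub).trans (le_of_eq ?_)
  rw [Measure.addHaar_preimage_linearMap _ (by rw [det_beltramiMap]; exact hκ2.ne'),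
    det_beltramiMap, Complex.volume_closedBall, abs_of_pos (inv_pos.2 hκ2),
    ← ENNReal.ofReal_pow hR.le, ← ENNReal.ofReal_coe_nnreal, NNReal.coe_real_pi,
    ← ENNReal.ofReal_mul (by positivity), ← ENNReal.ofReal_mul (by positivity)]
  congr 1
  ring

end Punctured

/-! ### The area theorem -/

/-- On a small circle, `beltramiMap` maps `z⁻¹ + c z + O(z²)` close to a circle. -/
theorem norm_beltramiMap_le {c k z : ℂ} {ρ C : ℝ} (hρ : 0 < ρ) (hρ1 : ρ ≤ 1) (hz : ‖z‖ = ρ)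
    (hk : ‖k‖ ≤ C) :
    ‖beltramiMap (-(ρ : ℂ) ^ 2 * c) (z⁻¹ + (c * z + z ^ 2 * k))‖ ≤
      ρ⁻¹ + (C + ‖c‖ ^ 2 + ‖c‖ * C) * ρ ^ 2 := by
  have hz0 : z ≠ 0 := norm_pos_iff.1 (hz ▸ hρ)
  have hC : 0 ≤ C := (norm_nonneg k).trans hk
  have hzz : z * (starRingEnd ℂ) z = (ρ : ℂ) ^ 2 := by
    rw [Complex.mul_conj, Complex.normSq_eq_norm_sq, hz]; push_cast; ring
  have hzc : (starRingEnd ℂ) z ≠ 0 := by simpa using hz0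
  have hkey : beltramiMap (-(ρ : ℂ) ^ 2 * c) (z⁻¹ + (c * z + z ^ 2 * k)) =
      z⁻¹ + z ^ 2 * k + -((ρ : ℂ) ^ 2 * (c * (starRingEnd ℂ) c) * (starRingEnd ℂ) z) +
        -((ρ : ℂ) ^ 2 * c * (starRingEnd ℂ) (z ^ 2 * k)) := by
    -- On `|z| = ρ` this makes `κ * conj z⁻¹` with `κ = -ρ² c` cancel `c z`. An enclosing disc
    -- without this correction would leave an area error that does not vanish with `ρ`.
    have h1 : (ρ : ℂ) ^ 2 * ((starRingEnd ℂ) z)⁻¹ = z := by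
      rw [← hzz]; field_simp
    rw [beltramiMap_apply]
    simp only [map_add, map_mul, map_inv₀]
    linear_combination (-c) * h1
  rw [hkey]
  refine (norm_add_le _ _).trans ?_
  refine (add_le_add_left (norm_add_le _ _) _).trans ?_
  refine (add_le_add_left (add_le_add_left (norm_add_le _ _) _) _).trans ?_
  simp only [norm_neg, norm_mul, norm_inv, norm_pow, hz, RCLike.norm_conj, Complex.norm_real,
    Real.norm_eq_abs, abs_of_pos hρ]
  have h1 : ρ ^ 2 * ‖k‖ ≤ ρ ^ 2 * C := by gcongr
  have h2 : ρ ^ 2 * (‖c‖ * ‖c‖) * ρ ≤ ρ ^ 2 * (‖c‖ * ‖c‖) * 1 := by gcongr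
  have h3 : ρ ^ 2 * ‖c‖ * (ρ ^ 2 * ‖k‖) ≤ ρ ^ 2 * ‖c‖ * (1 * C) := by
    gcongr
    exact pow_le_one₀ hρ.le hρ1
  nlinarith

/-- **Gronwall's area theorem** for `z⁻¹ + m z` injective on the punctured unit disc. -/
theorem area_theorem {m : ℂ → ℂ} (hm : DifferentiableOn ℂ m (ball 0 1)) (hm0 : m 0 = 0)
    (hinj : InjOn (fun z => z⁻¹ + m z) (ball 0 1 \ {0})) (N : ℕ) :
    ∑ n ∈ Finset.range N, (n + 1) * ‖taylorCoeff m (n + 1)‖ ^ 2 ≤ 1 := by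
  set S : ℝ → ℝ := fun r =>
    ∑ n ∈ Finset.range N, (n + 1) * ‖taylorCoeff m (n + 1)‖ ^ 2 * r ^ (2 * n + 2) with hS
  have hSc : Continuous S := by fun_prop
  obtain ⟨k, hk, hmk⟩ := exists_taylor_remainder 2 hm
  set c := taylorCoeff m 1
  obtain ⟨C, hC⟩ := (isCompact_closedBall (0 : ℂ) (1 / 2)).exists_bound_of_continuousOn
    (hk.continuousOn.mono (closedBall_subset_ball (by norm_num)))
  have hC0 : 0 ≤ C := (norm_nonneg _).trans (hC 0 (mem_closedBall_self (by norm_num)))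
  set D := C + ‖c‖ ^ 2 + ‖c‖ * C
  have hD : 0 ≤ D := by positivity
  have hstep : ∀ r ∈ Ioo (1 / 2 : ℝ) 1, S r ≤ (r ^ 2)⁻¹ := by
    intro r hr
    have hlim : Tendsto (fun ρ : ℝ =>
        S ρ + (2 * D * ρ + D ^ 2 * ρ ^ 4 + ρ ^ 2 * ‖c‖ ^ 2) / (1 - ρ ^ 4 * ‖c‖ ^ 2) + (r ^ 2)⁻¹)
        (𝓝[>] 0) (𝓝 ((r ^ 2)⁻¹)) := by
      have : ContinuousAt (fun ρ : ℝ =>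
        S ρ + (2 * D * ρ + D ^ 2 * ρ ^ 4 + ρ ^ 2 * ‖c‖ ^ 2) / (1 - ρ ^ 4 * ‖c‖ ^ 2) + (r ^ 2)⁻¹)
          0 := by
        refine ContinuousAt.add (ContinuousAt.add hSc.continuousAt
          (ContinuousAt.div ?_ ?_ (by norm_num))) continuousAt_const
        · fun_prop
        · fun_prop
      have h := this.tendsto.mono_left (nhdsWithin_le_nhds (s := Ioi 0))
      simpa [hS] using h
    have hsmall : ∀ᶠ ρ : ℝ in 𝓝[>] 0, ρ ^ 2 * ‖c‖ < 1 := by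
      have : ContinuousAt (fun ρ : ℝ => ρ ^ 2 * ‖c‖) 0 := by fun_prop
      refine (this.tendsto.eventually (gt_mem_nhds ?_)).filter_mono nhdsWithin_le_nhds
      norm_num
    refine ge_of_tendsto hlim ?_
    filter_upwards [hsmall, self_mem_nhdsWithin, Ioo_mem_nhdsGT (show (0 : ℝ) < 1 / 2 by norm_num)]
      with ρ hρc hρ hρ2
    have hρ : 0 < ρ := hρ
    have hκ : ‖-(ρ : ℂ) ^ 2 * c‖ = ρ ^ 2 * ‖c‖ := by
      simp
    have hR : 0 < ρ⁻¹ + D * ρ ^ 2 := by positivity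
    have hup := volume_image_annulus_le hm hinj hρ hr.2 (hρ2.2.trans hr.1).le hR
      (κ := -(ρ : ℂ) ^ 2 * c) (by rw [hκ]; exact hρc) (fun z hz => by
        have hz' : ‖z‖ = ρ := by simpa using hz
        have := norm_beltramiMap_le (c := c) (k := k z) hρ (by linarith [hρ2.2]) hz'
          (hC z (by rw [mem_closedBall_zero_iff, hz']; exact hρ2.2.le))
        convert this using 4
        rw [hmk z]
        simp [Finset.sum_range_succ, taylorCoeff_zero, hm0, c])
    have hlo := le_volume_image_annulus hm hinj hρ (hρ2.2.trans hr.1).le hr.2 N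
    have hden : 0 < 1 - ρ ^ 4 * ‖c‖ ^ 2 := by
      have : 0 ≤ ρ ^ 2 * ‖c‖ := by positivity
      nlinarith
    have hκ2 : 1 - ‖-(ρ : ℂ) ^ 2 * c‖ ^ 2 = 1 - ρ ^ 4 * ‖c‖ ^ 2 := by rw [hκ]; ring
    rw [hκ2] at hup
    have h := (ENNReal.ofReal_le_ofReal_iff
      (by have := Real.pi_pos; positivity)).1 (hlo.trans hup)
    rw [mul_div_assoc] at h
    have h := le_of_mul_le_mul_left h Real.pi_pos
    have hsum : ∑ n ∈ Finset.range N,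
        (n + 1) * ‖taylorCoeff m (n + 1)‖ ^ 2 * (r ^ (2 * n + 2) - ρ ^ (2 * n + 2)) =
        S r - S ρ := by
      simp only [hS, mul_sub, Finset.sum_sub_distrib]
    rw [hsum] at h
    -- Separates the divergent `ρ⁻²`, common to both area estimates, from a term that tends to `0`.
    have hid : (ρ⁻¹ + D * ρ ^ 2) ^ 2 / (1 - ρ ^ 4 * ‖c‖ ^ 2) = (ρ ^ 2)⁻¹ +
        (2 * D * ρ + D ^ 2 * ρ ^ 4 + ρ ^ 2 * ‖c‖ ^ 2) / (1 - ρ ^ 4 * ‖c‖ ^ 2) := by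
      field_simp
      ring
    rw [hid] at h
    linarith
  have h1 : Tendsto S (𝓝[<] 1) (𝓝 (S 1)) := hSc.continuousAt.tendsto.mono_left nhdsWithin_le_nhds
  have h2 : Tendsto (fun r : ℝ => (r ^ 2)⁻¹) (𝓝[<] 1) (𝓝 1) := by
    have : ContinuousAt (fun r : ℝ => (r ^ 2)⁻¹) 1 :=
      (continuousAt_id.pow 2).inv₀ (by norm_num)
    simpa using this.tendsto.mono_left (nhdsWithin_le_nhds (s := Iio 1))
  have h3 := le_of_tendsto_of_tendsto h1 h2 (by
    filter_upwards [Ioo_mem_nhdsLT (show (1 / 2 : ℝ) < 1 by norm_num)] with r hr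
    exact hstep r hr)
  simpa [hS] using h3

/-! ### Square root transform and Hankel determinants -/

theorem taylorCoeff_mul {f g : ℂ → ℂ} (hf : AnalyticAt ℂ f 0) (hg : AnalyticAt ℂ g 0) (n : ℕ) :
    taylorCoeff (fun z => f z * g z) n =
      ∑ i ∈ Finset.range (n + 1), taylorCoeff f i * taylorCoeff g (n - i) := by
  simp only [taylorCoeff]
  rw [iteratedDeriv_fun_mul hf.contDiffAt hg.contDiffAt, Finset.sum_div]
  refine Finset.sum_congr rfl fun i hi => ?_
  have hi : i ≤ n := Nat.lt_succ_iff.1 (Finset.mem_range.1 hi)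
  have h1 : (n.factorial : ℂ) ≠ 0 := by exact_mod_cast n.factorial_ne_zero
  have h2 : (i.factorial : ℂ) ≠ 0 := by exact_mod_cast i.factorial_ne_zero
  have h3 : ((n - i).factorial : ℂ) ≠ 0 := by exact_mod_cast (n - i).factorial_ne_zero
  have h4 : (n.choose i : ℂ) * i.factorial * (n - i).factorial = n.factorial := by
    exact_mod_cast Nat.choose_mul_factorial_mul_factorial hi
  field_simp
  linear_combination (iteratedDeriv i f 0 * iteratedDeriv (n - i) g 0) * h4

/-- A function of class `𝒮` is `z / φ z ^ 2` with `φ` holomorphic. -/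
theorem ClassS.exists_sqrt {f : ℂ → ℂ} (hf : f ∈ ClassS) :
    ∃ φ : ℂ → ℂ, DifferentiableOn ℂ φ (ball 0 1) ∧ φ 0 = 1 ∧
      ∀ z ∈ ball (0 : ℂ) 1, φ z * φ z * f z = z := by
  obtain ⟨hd, hinj, h0, h1⟩ := hf
  have hb : ball (0 : ℂ) 1 ∈ 𝓝 0 := ball_mem_nhds _ one_pos
  have hfz : ∀ z, f z = z * dslope f 0 z := fun z => by
    have := sub_smul_dslope f 0 z
    simpa [h0] using this.symm
  obtain ⟨φ, hφ, hφ0, h⟩ := exists_inverse_sqrt ((Complex.differentiableOn_dslope hb).2 hd)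
    (by simp [h1]) (fun z hz hz0 => by
      rcases eq_or_ne z 0 with rfl | hne
      · simp [h1] at hz0
      · exact hne (hinj hz (mem_ball_self one_pos) (by rw [hfz z, hz0, h0, mul_zero])))
  exact ⟨φ, hφ, hφ0, fun z hz => by rw [hfz z]; linear_combination z * h z hz⟩

/-- The area theorem for the odd square root transform of a univalent function. -/
theorem sum_taylorCoeff_sqrt_le {f φ : ℂ → ℂ} (hinj : InjOn f (ball 0 1))
    (hφ : DifferentiableOn ℂ φ (ball 0 1)) (hφ0 : φ 0 = 1)
    (h : ∀ z ∈ ball (0 : ℂ) 1, φ z * φ z * f z = z) :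
    ‖taylorCoeff φ 1‖ ^ 2 + 3 * ‖taylorCoeff φ 2‖ ^ 2 + 5 * ‖taylorCoeff φ 3‖ ^ 2 +
      7 * ‖taylorCoeff φ 4‖ ^ 2 ≤ 1 := by
  have hb : ball (0 : ℂ) 1 ∈ 𝓝 0 := ball_mem_nhds _ one_pos
  set ψ := dslope φ 0
  have hψ : DifferentiableOn ℂ ψ (ball 0 1) := (Complex.differentiableOn_dslope hb).2 hφ
  have hφψ : ∀ z, φ z = 1 + z * ψ z := fun z => by
    have := sub_smul_dslope φ 0 z
    simp only [sub_zero, smul_eq_mul, hφ0] at this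
    rw [this]; ring
  have hsq : ∀ z ∈ ball (0 : ℂ) 1, z ^ 2 ∈ ball (0 : ℂ) 1 := fun z hz => by
    rw [mem_ball_zero_iff] at hz ⊢
    rw [norm_pow]
    exact pow_lt_one₀ (norm_nonneg z) hz two_ne_zero
  set m : ℂ → ℂ := fun z => z * ψ (z ^ 2)
  have hm : DifferentiableOn ℂ m (ball 0 1) :=
    differentiableOn_id.mul (hψ.comp (differentiableOn_id.pow 2) hsq)
  have hmφ : ∀ z, z ≠ 0 → z⁻¹ + m z = φ (z ^ 2) / z := fun z hz => by
    rw [hφψ]; simp only [m]; field_simp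
  have hone : ∀ z ∈ ball (0 : ℂ) 1 \ {0}, (z⁻¹ + m z) ^ 2 * f (z ^ 2) = 1 := by
    intro z hz
    have hz0 : z ≠ 0 := hz.2
    rw [hmφ z hz0, div_pow, div_mul_eq_mul_div, div_eq_one_iff_eq (pow_ne_zero 2 hz0)]
    linear_combination h _ (hsq z hz.1)
  -- Equal values give `f (z²) = f (w²)`, hence `w = ±z`; the sign `-` is impossible because the
  -- function is odd and has no zero.
  have hminj : InjOn (fun z => z⁻¹ + m z) (ball 0 1 \ {0}) := by
    intro z hz w hw hzw
    have hz1 := hone z hz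
    have hw1 := hone w hw
    simp only at hzw
    have hne : z⁻¹ + m z ≠ 0 := fun h0 => by rw [h0] at hz1; simp at hz1
    rw [← hzw, ← hz1] at hw1
    have := hinj (hsq w hw.1) (hsq z hz.1) (mul_left_cancel₀ (pow_ne_zero 2 hne) hw1)
    rcases sq_eq_sq_iff_eq_or_eq_neg.1 this with h2 | h2
    · exact h2.symm
    · exfalso
      rw [h2] at hzw
      simp only [m, inv_neg, even_two, Even.neg_pow] at hzw hne
      exact hne (by linear_combination hzw / 2)
  obtain ⟨R, hR, hψR⟩ := exists_taylor_remainder 4 hψ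
  have hcoef : ∀ n < 9, taylorCoeff m n =
      if Odd n then taylorCoeff φ ((n + 1) / 2) else 0 := by
    intro n hn
    refine taylorCoeff_eq_of_expansion 9 (R := fun z => R (z ^ 2))
      (c := fun n => if Odd n then taylorCoeff φ ((n + 1) / 2) else 0) ?_
      (Eventually.of_forall fun z => ?_) hn
    · exact AnalyticAt.comp (g := R) (by simpa using hR.analyticAt hb) (analyticAt_id.pow 2)
    · have hφa := hφ.analyticAt hb
      simp only [m]
      rw [hψR (z ^ 2)]
      simp only [ψ, taylorCoeff_dslope hφa, Finset.sum_range_succ, Finset.sum_range_zero]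
      simp [Nat.odd_iff]
      ring
  -- This reaches the coefficients of `z, …, z⁷`: the even ones vanish, the odd ones carry weights
  -- 1, 3, 5, 7.
  have harea := area_theorem hm (by simp [m]) hminj 7
  simp only [Finset.sum_range_succ, Finset.sum_range_zero] at harea
  norm_num [hcoef, Nat.odd_iff] at harea
  linarith

/-- The first coefficients of a function of class `𝒮` in terms of those of the odd square root
transform, with the constraint given by the area theorem. -/
theorem ClassS.exists_coeffs {f : ℂ → ℂ} (hf : f ∈ ClassS) :
    ∃ a b e g : ℂ, ‖a‖ ^ 2 + 3 * ‖b‖ ^ 2 + 5 * ‖e‖ ^ 2 + 7 * ‖g‖ ^ 2 ≤ 1 ∧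
      taylorCoeff f 2 = 2 * a ∧ taylorCoeff f 3 = 2 * b + 3 * a ^ 2 ∧
      taylorCoeff f 4 = 2 * e + 6 * a * b + 4 * a ^ 3 ∧
      taylorCoeff f 5 = 2 * g + 6 * a * e + 3 * b ^ 2 + 12 * a ^ 2 * b + 5 * a ^ 4 := by
  have hb : ball (0 : ℂ) 1 ∈ 𝓝 0 := ball_mem_nhds _ one_pos
  obtain ⟨φ, hφ, hφ0, h⟩ := ClassS.exists_sqrt hf
  have hφa := hφ.analyticAt hb
  have hfa := hf.1.analyticAt hb
  have hp : ∀ n, taylorCoeff (fun z => φ z * φ z * f z) n = taylorCoeff (fun z => z) n :=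
    taylorCoeff_congr (mem_of_superset hb h)
  have hid : ∀ n < 6, taylorCoeff (fun z => z) n = if n = 1 then 1 else 0 := fun n hn =>
    taylorCoeff_eq_of_expansion 6 (R := fun _ => 0) (c := fun n => if n = 1 then 1 else 0)
      analyticAt_const (Eventually.of_forall fun z => by simp) hn
  have hφc : taylorCoeff φ 0 = 1 := by rw [taylorCoeff_zero, hφ0]
  have hf0 : taylorCoeff f 0 = 0 := by rw [taylorCoeff_zero, hf.2.2.1]
  have hf1 : taylorCoeff f 1 = 1 := by rw [taylorCoeff_one, hf.2.2.2]
  have e2 := (hp 2).trans (hid 2 (by norm_num))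
  have e3 := (hp 3).trans (hid 3 (by norm_num))
  have e4 := (hp 4).trans (hid 4 (by norm_num))
  have e5 := (hp 5).trans (hid 5 (by norm_num))
  simp only [taylorCoeff_mul (f := fun z => φ z * φ z) (hφa.mul hφa) hfa,
    taylorCoeff_mul hφa hφa, Finset.sum_range_succ, Finset.sum_range_zero, hφc, hf0, hf1]
    at e2 e3 e4 e5
  norm_num [hφc, hf0, hf1] at e2 e3 e4 e5
  refine ⟨-taylorCoeff φ 1, -taylorCoeff φ 2, -taylorCoeff φ 3, -taylorCoeff φ 4, ?_, ?_⟩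
  · simpa using sum_taylorCoeff_sqrt_le hf.2.1 hφ hφ0 h
  have t2 : taylorCoeff f 2 = -2 * taylorCoeff φ 1 := by linear_combination e2
  rw [t2] at e3 e4 e5 ⊢
  have t3 : taylorCoeff f 3 = -2 * taylorCoeff φ 2 + 3 * taylorCoeff φ 1 ^ 2 := by
    linear_combination e3
  rw [t3] at e4 e5 ⊢
  have t4 : taylorCoeff f 4 = -2 * taylorCoeff φ 3 + 6 * taylorCoeff φ 1 * taylorCoeff φ 2
      - 4 * taylorCoeff φ 1 ^ 3 := by
    linear_combination e4
  rw [t4] at e5 ⊢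
  refine ⟨by ring, by ring, by ring, ?_⟩
  linear_combination e5

theorem ClassS.exists_hankel {f : ℂ → ℂ} (hf : f ∈ ClassS) :
    ∃ a b e g : ℂ, ‖a‖ ^ 2 + 3 * ‖b‖ ^ 2 + 5 * ‖e‖ ^ 2 + 7 * ‖g‖ ^ 2 ≤ 1 ∧
      hankelTwoTwo f = 4 * a * e - a ^ 4 - 4 * b ^ 2 ∧
      hankelThreeOne f = 2 * g * (2 * b - a ^ 2) + 4 * a * b * e + 2 * a ^ 3 * e - 4 * e ^ 2
        - 3 * a ^ 2 * b ^ 2 - 2 * b ^ 3 := by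
  obtain ⟨a, b, e, g, h, h2, h3, h4, h5⟩ := ClassS.exists_coeffs hf
  refine ⟨a, b, e, g, h, ?_, ?_⟩
  · rw [hankelTwoTwo, Matrix.det_fin_two_of, h2, h3, h4]
    ring
  · rw [hankelThreeOne, Matrix.det_fin_three]
    simp [h2, h3, h4, h5]
    ring

/-! ### Polynomial inequalities -/

/-- Bernstein form on `[0, 4/7]`, `[4/7, 3/5]`, `[3/5, 1]`: on each interval all coefficients are
positive. The short middle interval contains the approximate maximiser `x ≈ 0.583` of `boundF2`. -/
theorem discriminant_minorant_nonneg {x : ℝ} (h0 : 0 ≤ x) (h1 : x ≤ 1) :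
    0 ≤ 325 + 9163 * x - 27169 * x ^ 2 + 50468 * x ^ 3 - 12389 * x ^ 4 - 256198 * x ^ 5 + 544047
      * x ^ 6 + 275748 * x ^ 7 - 1467317 * x ^ 8 - 2276625 * x ^ 9 + 4824421 * x ^ 10 := by
  rcases le_total x (4 / 7) with hx | hx
  · have key :
        (325 + 9163 * x - 27169 * x ^ 2 + 50468 * x ^ 3 - 12389 * x ^ 4 - 256198 * x ^ 5 +
          544047 * x ^ 6 + 275748 * x ^ 7 - 1467317 * x ^ 8 - 2276625 * x ^ 9 + 4824421 * x ^
          10) * 1048576 = 325 * (4 - 7 * x) ^ 10 + 59402 * x * (4 - 7 * x) ^ 9 + 2590997 * x ^ 2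
          * (4 - 7 * x) ^ 8 + 56917656 * x ^ 3 * (4 - 7 * x) ^ 7 + 778567850 * x ^ 4 * (4 - 7 *
          x) ^ 6 + 7042949148 * x ^ 5 * (4 - 7 * x) ^ 5 + 42076863346 * x ^ 6 * (4 - 7 * x) ^ 4
          + 173227785432 * x ^ 7 * (4 - 7 * x) ^ 3 + 518757637745 * x ^ 8 * (4 - 7 * x) ^ 2 +
          137935210090 * x ^ 9 * (4 - 7 * x) + 11728736537 * x ^ 10 := by ring
    have hb : 0 ≤ 4 - 7 * x := by linarith
    refine (mul_nonneg_iff_of_pos_right (c := 1048576) (by norm_num)).1 ?_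
    rw [key]
    positivity
  rcases le_total x (3 / 5) with hy | hy
  · have key :
        (325 + 9163 * x - 27169 * x ^ 2 + 50468 * x ^ 3 - 12389 * x ^ 4 - 256198 * x ^ 5 +
          544047 * x ^ 6 + 275748 * x ^ 7 - 1467317 * x ^ 8 - 2276625 * x ^ 9 + 4824421 * x ^
          10) = 11728736537 * (3 - 5 * x) ^ 10 + 53481721505 * (7 * x - 4) * (3 - 5 * x) ^ 9
          + 96540328925 * (7 * x - 4) ^ 2 * (3 - 5 * x) ^ 8 + 87297716112 * (7 * x - 4) ^ 3 * (3
          - 5 * x) ^ 7 + 53906133169 * (7 * x - 4) ^ 4 * (3 - 5 * x) ^ 6 + 61353509586 * (7 * x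
          - 4) ^ 5 * (3 - 5 * x) ^ 5 + 86787859760 * (7 * x - 4) ^ 6 * (3 - 5 * x) ^ 4 +
          74569041816 * (7 * x - 4) ^ 7 * (3 - 5 * x) ^ 3 + 35966471807 * (7 * x - 4) ^ 8 * (3 -
          5 * x) ^ 2 + 9210248830 * (7 * x - 4) ^ 9 * (3 - 5 * x)
          + 983557954 * (7 * x - 4) ^ 10 := by ring
    have ha : 0 ≤ 7 * x - 4 := by linarith
    have hb : 0 ≤ 3 - 5 * x := by linarith
    rw [key]
    positivity
  · have key :
        (325 + 9163 * x - 27169 * x ^ 2 + 50468 * x ^ 3 - 12389 * x ^ 4 - 256198 * x ^ 5 +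
          544047 * x ^ 6 + 275748 * x ^ 7 - 1467317 * x ^ 8 - 2276625 * x ^ 9 + 4824421 * x ^
          10) * 512 = 491778977 * (1 - x) ^ 10 + 5543120480 * (5 * x - 3) * (1 - x) ^ 9 +
          22426710889 * (5 * x - 3) ^ 2 * (1 - x) ^ 8 + 37357744032 * (5 * x - 3) ^ 3 * (1 - x)
          ^ 7 + 33921208594 * (5 * x - 3) ^ 4 * (1 - x) ^ 6 + 18988660128 * (5 * x - 3) ^ 5 * (1
          - x) ^ 5 + 6899640458 * (5 * x - 3) ^ 6 * (1 - x) ^ 4 + 1641540960 * (5 * x - 3) ^ 7 *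
          (1 - x) ^ 3 + 247875181 * (5 * x - 3) ^ 8 * (1 - x) ^ 2 + 21625600 * (5 * x - 3) ^ 9 *
          (1 - x) + 832237 * (5 * x - 3) ^ 10 := by ring
    have ha : 0 ≤ 5 * x - 3 := by linarith
    have hb : 0 ≤ 1 - x := by linarith
    refine (mul_nonneg_iff_of_pos_right (c := 512) (by norm_num)).1 ?_
    rw [key]
    positivity

theorem discriminant_pos {x : ℝ} (h0 : 0 ≤ x) (h1 : x ≤ 1) :
    0 < 4 * (927 / 400 - 267 / 100 * x + 1657 / 200 * x ^ 2 - 51 / 4 * x ^ 3 + 819 / 16 * x ^ 4)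
      * (1111463351 / 10000000000 - 80051 / 1000000 * x + 4706071 / 2000000 * x ^ 2
        + 16907 / 25000 * x ^ 3 - 883 / 80 * x ^ 4 - 21 / 4 * x ^ 5 + 377 / 16 * x ^ 6)
      - (33579 / 40000 - 660709 / 100000 * x + 235053 / 40000 * x ^ 2 - 16 * x ^ 4) ^ 2 := by
  -- The minorant has the coefficients of the discriminant rounded down to multiples of `1/1000`;
  -- the second summand restores the remainders.
  have h := add_pos_of_nonneg_of_pos
    (div_nonneg (discriminant_minorant_nonneg h0 h1) (show (0 : ℝ) ≤ 1000 by norm_num))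
    (show 0 < (4751959/7812500000 + (107265829/125000000000) * x +
        (69795841/250000000000) * x ^ 2 + (99699/625000000) * x ^ 3 + (1186761/10000000000) *
        x ^ 4 + (15729/20000000) * x ^ 5 + (6109/8000000) * x ^ 6 + (33/100000) * x ^ 7 +
        (1/8000) * x ^ 8 + (7/8000) * x ^ 10) by positivity)
  refine h.trans_eq ?_
  ring

/-- The upper bound for `boundF2` in the coordinates of the ellipsoid `x² + 3y² + s² = 1`. -/
theorem ellipsoid_bound_F2 {c x y s : ℝ} (hc : c ≤ 0.75593) (hx : 0 ≤ x) (hx1 : x ≤ 1)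
    (hy : 0 ≤ y) (hs : 0 ≤ s) (h : s ^ 2 = 1 - x ^ 2 - 3 * y ^ 2) :
    (c + 4 * x * y + 2 * x ^ 3) * s + 4 / 5 * s ^ 2 + 3 * x ^ 2 * y ^ 2 + 2 * y ^ 3 < 1.6788 := by
  have hy1 : y ≤ 0.58 := by nlinarith [sq_nonneg s, sq_nonneg x]
  -- `m` approximates the ratio `a / s` at the maximiser, where the AM-GM step below is then nearly
  -- sharp.
  set m : ℝ := 3 / 4 - x / 2 + 21 / 4 * x ^ 2 with hm
  have hm0 : 0 < m := by nlinarith [sq_nonneg (x - 1 / 21)]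
  set a : ℝ := 0.75593 + 4 * x * y + 2 * x ^ 3 with ha
  have hcs : c * s ≤ 0.75593 * s := mul_le_mul_of_nonneg_right hc hs
  have hamgm : 2 * m * (a * s) ≤ a ^ 2 + m ^ 2 * s ^ 2 := by nlinarith [sq_nonneg (a - m * s)]
  -- This is `(y - 0.205)² (0.58 - y) ≥ 0`, with `0.205` near the maximising `y`. It leaves a
  -- quadratic in `y`, settled by its discriminant.
  have hcube : y ^ 3 ≤ 0.99 * y ^ 2 - 0.279825 * y + 0.0243745 := by
    nlinarith [mul_nonneg (sq_nonneg (y - 0.205)) (sub_nonneg.2 hy1)]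
  have hmcube := mul_le_mul_of_nonneg_left hcube hm0.le
  obtain ⟨α, hα⟩ : ∃ α : ℝ, α = 927 / 400 - 267 / 100 * x + 1657 / 200 * x ^ 2 - 51 / 4 * x ^ 3 + 819 / 16 * x ^ 4 := ⟨_, rfl⟩
  obtain ⟨β, hβ⟩ : ∃ β : ℝ, β = 33579 / 40000 - 660709 / 100000 * x + 235053 / 40000 * x ^ 2 - 16 * x ^ 4 := ⟨_, rfl⟩
  obtain ⟨γ, hγ⟩ : ∃ γ : ℝ, γ = 1111463351 / 10000000000 - 80051 / 1000000 * x + 4706071 / 2000000 * x ^ 2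
    + 16907 / 25000 * x ^ 3 - 883 / 80 * x ^ 4 - 21 / 4 * x ^ 5 + 377 / 16 * x ^ 6 := ⟨_, rfl⟩
  have hα0 : 0 < α := by nlinarith [sq_nonneg (x - 0.3), sq_nonneg (x ^ 2 - x / 4)]
  have hquad : α * y ^ 2 + β * y + γ ≤ 2 * m * (1.6788 - (a * s + 4 / 5 * s ^ 2
      + 3 * x ^ 2 * y ^ 2 + 2 * y ^ 3)) := by
    have hid : α * y ^ 2 + β * y + γ = 2 * m * 1.6788 - (a ^ 2 + m ^ 2 * s ^ 2)
        - 8 / 5 * m * s ^ 2 - 6 * m * x ^ 2 * y ^ 2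
        - 4 * (m * (0.99 * y ^ 2 - 0.279825 * y + 0.0243745)) := by
      rw [h, hα, hβ, hγ, ha, hm]
      ring
    rw [hid]
    linarith
  have hdisc : 0 < 4 * α * γ - β ^ 2 := by
    rw [hα, hβ, hγ]
    exact discriminant_pos hx hx1
  have hpos : 0 < α * y ^ 2 + β * y + γ := by
    have : 0 < 4 * α * (α * y ^ 2 + β * y + γ) := by
      nlinarith [sq_nonneg (2 * α * y + β)]
    exact (mul_pos_iff_of_pos_left (by positivity)).1 this
  have := (mul_pos_iff_of_pos_left (by positivity)).1 (hpos.trans_le hquad)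
  simp only [ha] at this
  linarith

/-- The upper bound for `boundF1` in the coordinates of the ellipsoid `x² + 3y² + s² = 1`. -/
theorem ellipsoid_bound_F1 {p x y s : ℝ} (hp : 0 ≤ p) (hp2 : p ^ 2 = 16 / 5) (hx : 0 ≤ x)
    (h : s ^ 2 = 1 - x ^ 2 - 3 * y ^ 2) :
    p * x * s + x ^ 4 + 4 * y ^ 2 < 1.3615 := by
  have hy : 4 * y ^ 2 = 4 / 3 * (1 - x ^ 2 - s ^ 2) := by linarith
  rw [hy]
  -- For `x² ≥ 0.7` the vertex `3 p x / 8` of the quadratic in `s` lies beyond `√(1 - x²)`, so the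
  -- worst case is `y = 0`. For smaller `x`, AM-GM gives at most `4/3`.
  rcases le_total (x ^ 2) 0.7 with hu | hu
  · have h1 : p * x * s ≤ 4 / 3 * s ^ 2 + 3 / 5 * x ^ 2 := by
      nlinarith [sq_nonneg (3 * p * x - 8 * s)]
    nlinarith [mul_nonneg (sq_nonneg x) (sub_nonneg.2 hu)]
  · set S := Real.sqrt (1 - x ^ 2) with hS
    have hS2 : S ^ 2 = 1 - x ^ 2 := Real.sq_sqrt (by nlinarith)
    have hS0 : 0 ≤ S := Real.sqrt_nonneg _
    have hsS : s ≤ S := Real.le_sqrt_of_sq_le (by nlinarith [sq_nonneg y])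
    have hpx : 8 / 3 * S ≤ p * x := by
      refine abs_le_of_sq_le_sq' ?_ (by positivity) |>.2
      rw [mul_pow, mul_pow, hp2, hS2]
      linarith
    have h1 : p * x * s - 4 / 3 * s ^ 2 ≤ p * x * S - 4 / 3 * S ^ 2 := by
      nlinarith [mul_nonneg (sub_nonneg.2 hsS)
        (show 0 ≤ p * x - 4 / 3 * (S + s) by linarith)]
    have h2 : p * x * S < 1.3615 - x ^ 4 := by
      refine abs_lt_of_sq_lt_sq' ?_ (by nlinarith) |>.2
      rw [mul_pow, mul_pow, hp2, hS2]
      nlinarith [sq_nonneg (x ^ 4 - 0.7105), sq_nonneg (x ^ 2 - 0.8429),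
        sq_nonneg (x ^ 4 - 0.8429 ^ 2)]
    linarith

/-- Crude real bound for the expression of the third Hankel determinant. -/
theorem hankelThreeOne_real_bound {x y e g : ℝ} (hy : 0 ≤ y)
    (h : x ^ 2 + 3 * y ^ 2 + 5 * e ^ 2 + 7 * g ^ 2 ≤ 1) :
    2 * g * (2 * y + x ^ 2) + 4 * x * y * e + 2 * x ^ 3 * e + 4 * e ^ 2 + 3 * x ^ 2 * y ^ 2
      + 2 * y ^ 3 ≤ 1.6787 := by
  have hy1 : y ≤ 0.578 := by nlinarith [sq_nonneg x, sq_nonneg e, sq_nonneg g]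
  have h1 : 4 * g * y ≤ 0.44 * (7 * g ^ 2 + 3 * y ^ 2) := by
    nlinarith [sq_nonneg (g - 0.65 * y)]
  have h2 : 2 * g ≤ 7 * g ^ 2 + 1 / 7 := by nlinarith [sq_nonneg (7 * g - 1)]
  have h3 : 2 * x * e ≤ 0.448 * (x ^ 2 + 5 * e ^ 2) := by nlinarith [sq_nonneg (x - 2.236 * e)]
  have h4 : 4 * x * y * e ≤ 0.52 * (x ^ 2 + 5 * e ^ 2) := by
    nlinarith [mul_le_mul_of_nonneg_left h3 hy,
      mul_le_mul_of_nonneg_right hy1 (show 0 ≤ x ^ 2 + 5 * e ^ 2 by positivity)]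
  have h5 : 2 * y ^ 3 ≤ 1.156 * y ^ 2 := by
    nlinarith [mul_le_mul_of_nonneg_right hy1 (sq_nonneg y)]
  have h6 : x ^ 2 * (2 * g) ≤ x ^ 2 * (7 * g ^ 2 + 1 / 7) :=
    mul_le_mul_of_nonneg_left h2 (sq_nonneg x)
  have h7 : x ^ 2 * (2 * x * e) ≤ x ^ 2 * (0.448 * (x ^ 2 + 5 * e ^ 2)) :=
    mul_le_mul_of_nonneg_left h3 (sq_nonneg x)
  have h8 : x ^ 2 * (x ^ 2 + 3 * y ^ 2 + 5 * e ^ 2 + 7 * g ^ 2) ≤ x ^ 2 * 1 :=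
    mul_le_mul_of_nonneg_left h (sq_nonneg x)
  -- In the variables `x², 3y², 5e², 7g²` the total is linear with coefficients below `1.663, 0.826,
  -- 1.32, 0.44`; `h8` has absorbed the quartic terms into `x²`.
  nlinarith [mul_nonneg (sq_nonneg x) (sq_nonneg x), mul_nonneg (sq_nonneg x) (sq_nonneg e),
    sq_nonneg y, sq_nonneg e, sq_nonneg g, sq_nonneg x]

/-! ### Maxima over `domainD` -/

theorem isCompact_domainD : IsCompact domainD := by
  refine (isCompact_Icc (a := ((0, 0) : ℝ × ℝ)) (b := (1, 1))).of_isClosed_subset ?_ ?_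
  · have h : domainD = {p : ℝ × ℝ | 0 ≤ p.1} ∩ ({p | p.1 ≤ 1} ∩ ({p | 0 ≤ p.2} ∩
        {p | p.2 ≤ 1 / Real.sqrt 3 * Real.sqrt (1 - p.1 ^ 2)})) := rfl
    rw [h]
    refine (isClosed_le ?_ ?_).inter ((isClosed_le ?_ ?_).inter ((isClosed_le ?_ ?_).inter
      (isClosed_le ?_ ?_))) <;> fun_prop
  · rintro ⟨x, y⟩ ⟨h0, h1, h2, h3⟩
    refine ⟨⟨h0, h2⟩, ⟨h1, h3.trans ?_⟩⟩
    refine mul_le_one₀ ?_ (Real.sqrt_nonneg _) ?_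
    · rw [div_le_one (by positivity), Real.one_le_sqrt]; norm_num
    · exact Real.sqrt_le_iff.2 ⟨zero_le_one, by nlinarith⟩

theorem mem_domainD_iff {x y : ℝ} :
    (x, y) ∈ domainD ↔ 0 ≤ x ∧ x ≤ 1 ∧ 0 ≤ y ∧ 0 ≤ 1 - x ^ 2 - 3 * y ^ 2 := by
  simp only [domainD, mem_ofPred_eq]
  refine and_congr_right fun h0 => and_congr_right fun h1 => and_congr_right fun h2 => ?_
  rw [one_div, inv_mul_eq_div, ← Real.sqrt_div' _ (by norm_num), Real.le_sqrt h2,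
    le_div_iff₀ (by norm_num)]
  · constructor <;> intro h <;> linarith
  · nlinarith

theorem exists_isGreatest_domainD {F : ℝ × ℝ → ℝ} (hF : Continuous F) {l u : ℝ}
    (hl : ∃ p ∈ domainD, l ≤ F p) (hu : ∀ p ∈ domainD, F p < u) :
    ∃ A, IsGreatest (F '' domainD) A ∧ l ≤ A ∧ A < u := by
  obtain ⟨p, hp, hlp⟩ := hl
  obtain ⟨A, hA⟩ := (isCompact_domainD.image hF).exists_isGreatest ⟨_, p, hp, rfl⟩
  refine ⟨A, hA, hlp.trans (hA.2 ⟨p, hp, rfl⟩), ?_⟩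
  obtain ⟨q, hq, rfl⟩ := hA.1
  exact hu q hq

theorem exists_isGreatest_boundF1 :
    ∃ A, IsGreatest (boundF1 '' domainD) A ∧ 1.3614 ≤ A ∧ A < 1.3615 := by
  have h5 : (0 : ℝ) < Real.sqrt 5 := by positivity
  refine exists_isGreatest_domainD (by unfold boundF1; fun_prop)
    -- A decimal approximation to the maximiser.
    ⟨(0.9181, 0), mem_domainD_iff.2 (by norm_num), ?_⟩ ?_
  · have h1 : (1.78885 : ℝ) ≤ 4 / Real.sqrt 5 := by
      rw [le_div_iff₀ h5, ← le_div_iff₀' (by norm_num), Real.sqrt_le_left (by norm_num)]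
      norm_num
    have h2 : (0.39634 : ℝ) ≤ Real.sqrt (1 - 0.9181 ^ 2 - 3 * 0 ^ 2) :=
      Real.le_sqrt_of_sq_le (by norm_num)
    have h3 := mul_le_mul h1 h2 (by norm_num) (by positivity)
    simp only [boundF1]
    nlinarith
  · rintro ⟨x, y⟩ hp
    obtain ⟨h0, h1, h2, h3⟩ := mem_domainD_iff.1 hp
    exact ellipsoid_bound_F1 (by positivity)
      (by rw [div_pow, Real.sq_sqrt (by norm_num)]; norm_num) h0 (Real.sq_sqrt h3)

theorem exists_isGreatest_boundF2 :
    ∃ B, IsGreatest (boundF2 '' domainD) B ∧ 1.6787 ≤ B ∧ B < 1.6788 := by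
  have h7 : (0 : ℝ) < Real.sqrt 7 := by positivity
  refine exists_isGreatest_domainD (by unfold boundF2; fun_prop)
    ⟨(0.58324, 0.20644), mem_domainD_iff.2 (by norm_num), ?_⟩ ?_
  · have h1 : (0.755925 : ℝ) ≤ 2 / Real.sqrt 7 := by
      rw [le_div_iff₀ h7, ← le_div_iff₀' (by norm_num), Real.sqrt_le_left (by norm_num)]
      norm_num
    have h2 : (0.729367 : ℝ) ≤ Real.sqrt (1 - 0.58324 ^ 2 - 3 * 0.20644 ^ 2) :=
      Real.le_sqrt_of_sq_le (by norm_num)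
    have h3 := mul_le_mul
      (show (0.755925 + 4 * 0.58324 * 0.20644 + 2 * 0.58324 ^ 3 : ℝ) ≤
        2 / Real.sqrt 7 + 4 * 0.58324 * 0.20644 + 2 * 0.58324 ^ 3 by linarith)
      h2 (by norm_num) (by positivity)
    simp only [boundF2]
    generalize Real.sqrt (1 - 0.58324 ^ 2 - 3 * 0.20644 ^ 2) = s at *
    linarith
  · rintro ⟨x, y⟩ hp
    obtain ⟨h0, h1, h2, h3⟩ := mem_domainD_iff.1 hp
    have hsq := Real.sq_sqrt h3
    have := ellipsoid_bound_F2 (c := 2 / Real.sqrt 7) (by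
      rw [div_le_iff₀ h7, ← div_le_iff₀' (by norm_num)]
      exact Real.le_sqrt_of_sq_le (by norm_num)) h0 h1 h2 (Real.sqrt_nonneg _) hsq
    simp only [boundF2]
    linarith

/-! ### Bounds for the determinants -/

theorem norm_hankelTwoTwo_le_boundF1 {a b e : ℂ}
    (h : ‖a‖ ^ 2 + 3 * ‖b‖ ^ 2 + 5 * ‖e‖ ^ 2 ≤ 1) :
    ‖4 * a * e - a ^ 4 - 4 * b ^ 2‖ ≤ boundF1 (‖a‖, ‖b‖) := by
  have he : Real.sqrt 5 * ‖e‖ ≤ Real.sqrt (1 - ‖a‖ ^ 2 - 3 * ‖b‖ ^ 2) := by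
    refine Real.le_sqrt_of_sq_le ?_
    rw [mul_pow, Real.sq_sqrt (by norm_num)]
    linarith
  have h5 : (0 : ℝ) < Real.sqrt 5 := by positivity
  have h1 : 4 * ‖a‖ * ‖e‖ ≤
      4 / Real.sqrt 5 * ‖a‖ * Real.sqrt (1 - ‖a‖ ^ 2 - 3 * ‖b‖ ^ 2) := by
    have := mul_le_mul_of_nonneg_left he (show 0 ≤ 4 / Real.sqrt 5 * ‖a‖ by positivity)
    refine le_trans (le_of_eq ?_) this
    field_simp
  refine (norm_sub_le _ _).trans ((add_le_add_left (norm_sub_le _ _) _).trans ?_)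
  simp only [norm_mul, norm_pow, boundF1, Complex.norm_ofNat]
  linarith

theorem norm_hankelThreeOne_le {a b e g : ℂ}
    (h : ‖a‖ ^ 2 + 3 * ‖b‖ ^ 2 + 5 * ‖e‖ ^ 2 + 7 * ‖g‖ ^ 2 ≤ 1) :
    ‖2 * g * (2 * b - a ^ 2) + 4 * a * b * e + 2 * a ^ 3 * e - 4 * e ^ 2 - 3 * a ^ 2 * b ^ 2
      - 2 * b ^ 3‖ ≤ 1.6787 := by
  refine le_trans ?_ (hankelThreeOne_real_bound (norm_nonneg b) h)
  have h1 : ‖2 * b - a ^ 2‖ ≤ 2 * ‖b‖ + ‖a‖ ^ 2 := by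
    refine (norm_sub_le _ _).trans (le_of_eq ?_)
    simp
  refine (norm_sub_le _ _).trans (add_le_add ((norm_sub_le _ _).trans (add_le_add
    ((norm_sub_le _ _).trans (add_le_add ((norm_add_le _ _).trans (add_le_add
      ((norm_add_le _ _).trans (add_le_add ?_ ?_)) ?_)) ?_)) ?_)) ?_)
  · rw [norm_mul, norm_mul, Complex.norm_ofNat]
    gcongr
  all_goals simp

theorem theorem2 :
    ∃ A B : ℝ,
      (IsGreatest (boundF1 '' domainD) A ∧ 1.3614 ≤ A ∧ A < 1.3615) ∧
      (IsGreatest (boundF2 '' domainD) B ∧ 1.6787 ≤ B ∧ B < 1.6788) ∧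
      (∀ f ∈ ClassS, ‖hankelTwoTwo f‖ ≤ A) ∧
      (∀ f ∈ ClassS, ‖hankelThreeOne f‖ ≤ B) := by
  obtain ⟨A, hA⟩ := exists_isGreatest_boundF1
  obtain ⟨B, hB⟩ := exists_isGreatest_boundF2
  refine ⟨A, B, hA, hB, fun f hf => ?_, fun f hf => ?_⟩
  · obtain ⟨a, b, e, g, h, h2, -⟩ := ClassS.exists_hankel hf
    have hg : 0 ≤ ‖g‖ ^ 2 := by positivity
    have he : 0 ≤ ‖e‖ ^ 2 := by positivity
    have hb : 0 ≤ ‖b‖ ^ 2 := by positivity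
    rw [h2]
    refine (norm_hankelTwoTwo_le_boundF1 (by linarith)).trans (hA.1.2 ⟨_, ?_, rfl⟩)
    exact mem_domainD_iff.2 ⟨norm_nonneg a, (sq_le_one_iff₀ (norm_nonneg a)).1 (by linarith),
      norm_nonneg b, by linarith⟩
  · obtain ⟨a, b, e, g, h, -, h3⟩ := ClassS.exists_hankel hf
    rw [h3]
    -- Only the lower bound `1.6787 ≤ B` is needed here.
    exact (norm_hankelThreeOne_le h).trans hB.2.1
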